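/- \textbf{Proposition (discreteness).} Let $\Delta$ be a (non-empty) right-angled building of type $M=(m_{ij})_{i,j\in I}$ over a finite index set $I$ (so $m_{ij}\in\{2,\infty\}$ for all $i\neq j$), viewed as a chamber system, and assume that $\Delta$ is semiregular with parameters $(q_i)_{i\in I}$, i.e.\ all $i$-panels have the same, possibly infinite, cardinality $q_i\ge 2$. For every $i\in I$ let $X_i$ be a set with $|X_i|=q_i$ and let $F_i\le \operatorname{Sym}(X_i)$ be any permutation group. Let $\lambda=(\lambda_i)_{i\in I}\colon\Delta\to\prod_{i\in I}X_i$ be a legal colouring: for every $i\in I$ and every $i$-panel $\mathcal P$, the restriction $\lambda_i|_{\mathcal P}\colon\mathcal P\to X_i$ is a bijection, and $\lambda_j|_{\mathcal P}$ is constant for every $j\ne i$. For a type-preserving automorphism $g$ of $\Delta$ and an $i$-panel $\mathcal P$ put \[\sigma_\lambda(g,\mathcal P)=\lambda_i|_{g\mathcal P}\circ g|_{\mathcal P}\circ(\lambda_i|_{\mathcal P})^{-1}\in\operatorname{Sym}(X_i),\] and let \[U(\boldsymbol F)=\{g\in\operatorname{Aut}(\Delta)\mid \sigma_\lambda(g,\mathcal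 P)\in F_i\text{ for every } i\in I\text{ and every }i\text{-panel }\mathcal P\}.\] Equip $U(\boldsymbol F)$, a permutation group of the set of chambers of $\Delta$, with the permutation topology, for which the pointwise stabilisers of finite sets of chambers form a neighbourhood basis of the identity. Consider the conditions: \begin{enumerate} \item[(i)] each $F_i$ acts freely on $X_i$; \item[(ii)] $U(\boldsymbol F)$ acts freely on the set of chambers of $\Delta$; \item[(iii)] $U(\boldsymbol F)$ is a discrete topological group. \end{enumerate} Then (i) and (ii) are equivalent, and they imply (iii). If moreover the Coxeter diagram of $\Delta$ has no isolated nodes (i.e.\ for every $i\in I$ there is some $j\in I$ with $m_{ij}=\infty$), then (i), (ii) and (iii) are equivalent. -/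

import Mathlib

universe u v w

/-! ### Permutation topology -/

/-- The pointwise stabilisers of finite subsets of `X`, as a basis of neighbourhoods of the
identity of a permutation group `G ≤ Sym(X)`. -/
@[reducible]
def permutationBasis {X : Type*} (G : Subgroup (Equiv.Perm X)) : GroupFilterBasis G where
  sets := {V | ∃ Φ : Finset X, V = (fixingSubgroup G (Φ : Set X) : Set G)}
  nonempty := ⟨_, ∅, rfl⟩
  inter_sets := by
    classical
    rintro _ _ ⟨Φ, rfl⟩ ⟨Ψ, rfl⟩
    refine ⟨_, ⟨Φ ∪ Ψ, rfl⟩, fun g hg => ?_⟩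
    simp only [SetLike.mem_coe, mem_fixingSubgroup_iff, Set.mem_inter_iff] at hg ⊢
    exact ⟨fun y hy => hg y (by simp_all), fun y hy => hg y (by simp_all)⟩
  one' := by
    rintro _ ⟨Φ, rfl⟩
    exact one_mem _
  mul' := by
    rintro _ ⟨Φ, rfl⟩
    refine ⟨_, ⟨Φ, rfl⟩, ?_⟩
    rintro _ ⟨a, ha, b, hb, rfl⟩
    exact mul_mem ha hb
  inv' := by
    rintro _ ⟨Φ, rfl⟩
    exact ⟨_, ⟨Φ, rfl⟩, fun g hg => inv_mem hg⟩
  conj' := by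
    classical
    rintro g _ ⟨Φ, rfl⟩
    refine ⟨_, ⟨Φ.image (fun x => g⁻¹ • x), rfl⟩, fun h hh => ?_⟩
    simp only [SetLike.mem_coe, mem_fixingSubgroup_iff, Set.mem_preimage] at hh ⊢
    intro y hy
    have := hh (g⁻¹ • y) (Finset.mem_coe.2 (Finset.mem_image_of_mem _ hy))
    rw [mul_smul, mul_smul, this, smul_inv_smul]

/-- The permutation topology on a permutation group `G ≤ Sym(X)`. -/
@[reducible]
def permutationTopology {X : Type*} (G : Subgroup (Equiv.Perm X)) : TopologicalSpace G :=
  (permutationBasis G).topology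

/-! ### Chamber systems and buildings -/

/-- A chamber system over `I` with set of chambers `C`: for each `i : I`, an equivalence
relation on `C`, called `i`-adjacency. -/
structure ChamberSystem (I C : Type*) where
  adj : I → Setoid C

namespace ChamberSystem

variable {I C : Type*} (S : ChamberSystem I C)

/-- `S.HasGallery f x y`: there is a (non-stuttering) gallery of type `f` from `x` to `y`. -/
inductive HasGallery : List I → C → C → Prop
  | nil (x : C) : HasGallery [] x x
  | cons {i : I} {f : List I} {x y z : C} (hxy : S.adj i x y) (hne : x ≠ y)
      (h : HasGallery f y z) : HasGallery (i :: f) x z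

/-- The `i`-panels (residues of type `{i}`) are the equivalence classes of `i`-adjacency. -/
def Panel (i : I) : Type _ := {P : Set C // P ∈ (S.adj i).classes}

/-- The `i`-panel containing the chamber `c`. -/
def panelOf (i : I) (c : C) : S.Panel i := ⟨{d | S.adj i d c}, Setoid.mem_classes _ c⟩

/-- A building of type `M` (an entry `0` of `M` stands for `∞`): a chamber system in which every
panel has at least two chambers, together with a Weyl distance `δ` such that for each reduced
word `f`, `δ x y` is the element represented by `f` if and only if `x` and `y` are joined by a
gallery of type `f`. -/
def IsBuilding (M : CoxeterMatrix I) : Prop :=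
  (∀ i (P : S.Panel i), P.1.Nontrivial) ∧
  ∃ δ : C → C → M.Group, ∀ (x y : C) (f : List I), M.toCoxeterSystem.IsReduced f →
    (δ x y = M.toCoxeterSystem.wordProd f ↔ S.HasGallery f x y)

/-- All `i`-panels have the same cardinality `q i ≥ 2`. -/
def IsSemiregular (q : I → Cardinal) : Prop :=
  ∀ i, 2 ≤ q i ∧ ∀ P : S.Panel i, Cardinal.mk P.1 = q i

/-- The group of type-preserving automorphisms. -/
def autGroup : Subgroup (Equiv.Perm C) where
  carrier := {g | ∀ i c d, S.adj i (g c) (g d) ↔ S.adj i c d}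
  one_mem' := fun _ _ _ => Iff.rfl
  mul_mem' := fun {g h} hg hh i c d => (hg i (h c) (h d)).trans (hh i c d)
  inv_mem' := fun {g} hg i c d => by simpa using (hg i (g⁻¹ c) (g⁻¹ d)).symm

variable {S}

theorem image_mem_classes (g : S.autGroup) (i : I) (P : S.Panel i) :
    (g : Equiv.Perm C) '' P.1 ∈ (S.adj i).classes := by
  obtain ⟨P, hP⟩ := P
  obtain ⟨c, rfl⟩ := hP
  refine ⟨g.1 c, Set.ext fun d => ?_⟩
  constructor
  · rintro ⟨e, he, rfl⟩
    exact (g.2 i e c).2 he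
  · intro hd
    obtain ⟨e, rfl⟩ := g.1.surjective d
    exact ⟨e, (g.2 i e c).1 hd, rfl⟩

/-- The image of a panel under an automorphism. -/
def mapPanel (g : S.autGroup) {i : I} (P : S.Panel i) : S.Panel i :=
  ⟨(g : Equiv.Perm C) '' P.1, image_mem_classes g i P⟩

/-- The restriction `P → gP` of the automorphism `g` to the panel `P`. -/
def restrictPanel (g : S.autGroup) {i : I} (P : S.Panel i) : P.1 ≃ (mapPanel g P).1 :=
  (g : Equiv.Perm C).image P.1

variable (S)

/-- A legal colouring `C → ∏ i, X i`. -/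
structure LegalColouring (X : I → Type*) where
  toFun : C → ∀ i, X i
  bijOn : ∀ i (P : S.Panel i), Set.BijOn (fun c => toFun c i) P.1 Set.univ
  const : ∀ i (P : S.Panel i) j, j ≠ i → ∀ c ∈ P.1, ∀ d ∈ P.1, toFun c j = toFun d j

end ChamberSystem

namespace ChamberSystem.LegalColouring

variable {I C : Type*} {S : ChamberSystem I C} {X : I → Type*} (col : S.LegalColouring X)

/-- The bijection `P → X i` obtained by restricting the `i`-th colour to an `i`-panel `P`. -/
noncomputable def panelEquiv {i : I} (P : S.Panel i) : P.1 ≃ X i :=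
  ((col.bijOn i P).equiv _).trans (Equiv.Set.univ (X i))

/-- The local action of the automorphism `g` at the `i`-panel `P`. -/
noncomputable def localAction (g : S.autGroup) {i : I} (P : S.Panel i) : Equiv.Perm (X i) :=
  ((col.panelEquiv P).symm.trans (restrictPanel g P)).trans (col.panelEquiv (mapPanel g P))

theorem localAction_apply (g : S.autGroup) {i : I} (P : S.Panel i) {c : C} (hc : c ∈ P.1) :
    col.localAction g P (col.toFun c i) = col.toFun (g.1 c) i := by
  have h : (col.panelEquiv P).symm (col.toFun c i) = ⟨c, hc⟩ :=
    (col.panelEquiv P).symm_apply_eq.2 rfl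
  simp only [localAction, Equiv.trans_apply, h]
  rfl

theorem localAction_eq (g : S.autGroup) {i : I} (P : S.Panel i) (f : Equiv.Perm (X i))
    (h : ∀ c ∈ P.1, f (col.toFun c i) = col.toFun (g.1 c) i) : col.localAction g P = f := by
  ext x
  obtain ⟨c, hc, rfl⟩ := (col.bijOn i P).surjOn (Set.mem_univ x)
  exact (col.localAction_apply g P hc).trans (h c hc).symm

theorem localAction_one {i : I} (P : S.Panel i) : col.localAction 1 P = 1 :=
  col.localAction_eq _ _ _ fun _ _ => rfl

theorem localAction_mul (g h : S.autGroup) {i : I} (P : S.Panel i) :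
    col.localAction (g * h) P = col.localAction g (mapPanel h P) * col.localAction h P := by
  refine col.localAction_eq _ _ _ fun c hc => ?_
  rw [Equiv.Perm.mul_apply, col.localAction_apply h P hc]
  exact col.localAction_apply g (mapPanel h P) ⟨c, hc, rfl⟩

theorem localAction_inv (g : S.autGroup) {i : I} (P : S.Panel i) :
    col.localAction g⁻¹ P = (col.localAction g (mapPanel g⁻¹ P))⁻¹ := by
  refine col.localAction_eq _ _ _ fun c hc => ?_
  have h : g⁻¹.1 c ∈ (mapPanel g⁻¹ P).1 := ⟨c, hc, rfl⟩
  have h2 : g.1 (g⁻¹.1 c) = c := by simp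
  rw [Equiv.Perm.inv_eq_iff_eq, col.localAction_apply g _ h, h2]

/-- The universal group `U(F)`, as a permutation group of the set of chambers: the automorphisms
all of whose local actions at `i`-panels lie in `F i`. -/
def universalGroup (F : ∀ i, Subgroup (Equiv.Perm (X i))) : Subgroup (Equiv.Perm C) where
  carrier := {g | ∃ hg : g ∈ S.autGroup, ∀ i (P : S.Panel i), col.localAction ⟨g, hg⟩ P ∈ F i}
  one_mem' := ⟨one_mem _, fun i P => by
    have := col.localAction_one P
    exact this ▸ one_mem (F i)⟩
  mul_mem' := by
    rintro g h ⟨hg, hgF⟩ ⟨hh, hhF⟩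
    refine ⟨mul_mem hg hh, fun i P => ?_⟩
    have := col.localAction_mul ⟨g, hg⟩ ⟨h, hh⟩ P
    exact this ▸ mul_mem (hgF i _) (hhF i P)
  inv_mem' := by
    rintro g ⟨hg, hgF⟩
    refine ⟨inv_mem hg, fun i P => ?_⟩
    have := col.localAction_inv ⟨g, hg⟩ P
    exact this ▸ inv_mem (hgF i _)

end ChamberSystem.LegalColouring

/-! ### Coxeter diagrams -/

namespace CoxeterMatrix

variable {I : Type*} (M : CoxeterMatrix I)

/-- `m i j = 2` or `m i j = ∞` (encoded by `0`) for all distinct `i`, `j`. -/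
def IsRightAngled : Prop := ∀ i j, i ≠ j → M i j = 2 ∨ M i j = 0

/-- The graph underlying the Coxeter diagram: distinct nodes `i`, `j` are joined by an edge if
and only if `m i j ≠ 2`. -/
def diagram : SimpleGraph I where
  Adj i j := i ≠ j ∧ M i j ≠ 2
  symm := ⟨fun i j h => ⟨h.1.symm, by rw [M.symmetric]; exact h.2⟩⟩
  loopless := ⟨fun _ h => h.1 rfl⟩

end CoxeterMatrix

/-!
If the local actions are free, then an element of `U(F)` fixing a chamber fixes all adjacent
chambers, hence every chamber by connectedness. Point stabilisers are then trivial and open, so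
`U(F)` is discrete.

Conversely, let `f ∈ F i` be non-trivial with a fixed colour `x`, and let `c` be a chamber with
`i`-colour `x`. One can leave the `i`-wing of `c`, the set of chambers projecting to `c` on the
`i`-panel of `c`, only through `i`-panels and only from chambers with `i`-colour `x`. Hence applying
`f` to the `i`-colours on all `i`-panels not contained in the wing yields another legal colouring,
which agrees with the old one on the wing. Legal colourings are unique up to automorphisms, so this
recolouring is induced by a non-trivial element of `U(F)` which fixes the wing pointwise, and `U(F)`
is not free. If moreover `m i j = ∞`, then crossing an `i`-panel and then a `j`-panel leads to a
chamber whose `i`-wing contains the wing of `c` together with all adjacent chambers; so every finite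
set of chambers lies in such a wing, and `U(F)` is not discrete.

Uniqueness of legal colourings is a covering argument. In the fibre product of two coloured
buildings over the set of colours every gallery can be made reduced by commutations, because
commuting squares can be filled there, and a closed gallery of reduced type in a building is
trivial. So a connected component of the fibre product is the graph of a colour-preserving
isomorphism. What is needed about reduced words is that a letter is a left descent of a reduced word
only if commutations bring it to the front, which is read off from the signs in the dual of the
geometric representation of the Coxeter group.
-/

/-! ### Words in right-angled Coxeter groups -/

namespace RightAngled

variable {I W : Type*} {M : CoxeterMatrix I} [Group W] {cs : CoxeterSystem M W}

variable (M) in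
/-- Commutations bring some occurrence of the letter `k` to the front of the word `l`. For a
reduced word of a right-angled Coxeter group this encodes the left descents. -/
def CommutesToFront (k : I) (l : List I) : Prop :=
  ∃ u v, l = u ++ k :: v ∧ ∀ j ∈ u, M k j = 2

theorem commutesToFront_cons {k j : I} {l : List I} :
    CommutesToFront M k (j :: l) ↔ k = j ∨ M k j = 2 ∧ CommutesToFront M k l := by
  constructor
  · rintro ⟨_ | ⟨a, u⟩, v, hl, hu⟩ <;>
      obtain ⟨rfl, rfl⟩ := List.cons_eq_cons.1 hl
    · exact .inl rfl
    · rw [List.forall_mem_cons] at hu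
      exact .inr ⟨hu.1, u, v, rfl, hu.2⟩
  · rintro (rfl | ⟨hkj, u, v, rfl, hu⟩)
    · exact ⟨[], l, rfl, by simp⟩
    · exact ⟨j :: u, v, rfl, List.forall_mem_cons.2 ⟨hkj, hu⟩⟩

theorem not_commutesToFront_nil (k : I) : ¬ CommutesToFront M k [] := by
  simp [CommutesToFront]

theorem CommutesToFront.of_append_singleton {k a : I} {l : List I}
    (h : CommutesToFront M k (l ++ [a])) (hl : ¬ CommutesToFront M k l) :
    k = a ∧ ∀ j ∈ l, M k j = 2 := by
  obtain ⟨u, v, huv, hu⟩ := h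
  obtain rfl | ⟨v, b, rfl⟩ := v.eq_nil_or_concat
  · obtain ⟨rfl, hka⟩ := List.append_inj' huv rfl
    exact ⟨(List.singleton_inj.1 hka).symm, hu⟩
  · have huv' : l ++ [a] = (u ++ k :: v) ++ [b] := by simpa using huv
    exact (hl ⟨u, v, (List.append_inj' huv' rfl).1, hu⟩).elim

theorem ne_of_apply_eq_two {i j : I} (h : M i j = 2) : i ≠ j := by
  rintro rfl
  simp at h

theorem ne_of_apply_eq_zero {i j : I} (h : M i j = 0) : i ≠ j := by
  rintro rfl
  simp at h

theorem commute_simple {i j : I} (h : M i j = 2) : Commute (cs.simple i) (cs.simple j) := by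
  have hsq := cs.simple_mul_simple_pow i j
  rw [h, pow_two] at hsq
  rw [commute_iff_eq, eq_inv_of_mul_eq_one_left hsq, mul_inv_rev, cs.inv_simple, cs.inv_simple]

theorem commute_simple_wordProd {k : I} {l : List I} (h : ∀ j ∈ l, M k j = 2) :
    Commute (cs.simple k) (cs.wordProd l) :=
  Commute.list_prod_right _ _ <| List.forall_mem_map.2 fun j hj => commute_simple (h j hj)

theorem wordProd_append_cons_of_commute {k : I} {u : List I} (h : ∀ j ∈ u, M k j = 2)
    (v : List I) : cs.wordProd (u ++ k :: v) = cs.wordProd (k :: (u ++ v)) := by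
  simp only [cs.wordProd_append, cs.wordProd_cons, ← mul_assoc, (commute_simple_wordProd h).eq]

theorem isReduced_of_wordProd_eq {l l' : List I} (hl : cs.IsReduced l)
    (h : cs.wordProd l = cs.wordProd l') (hlen : l.length = l'.length) : cs.IsReduced l' := by
  rw [CoxeterSystem.IsReduced, ← h, hl.eq, hlen]

theorem isReduced_of_append {l t : List I} (h : cs.IsReduced (l ++ t)) : cs.IsReduced l := by
  simpa using h.take l.length

theorem isReduced_of_cons {k : I} {l : List I} (h : cs.IsReduced (k :: l)) : cs.IsReduced l :=
  h.drop 1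

theorem isReduced_singleton (k : I) : cs.IsReduced [k] := by
  simp [CoxeterSystem.IsReduced]

theorem isReduced_cons_iff_not_isLeftDescent {k : I} {l : List I} (hl : cs.IsReduced l) :
    cs.IsReduced (k :: l) ↔ ¬ cs.IsLeftDescent (cs.wordProd l) k := by
  rw [cs.not_isLeftDescent_iff, CoxeterSystem.IsReduced, cs.wordProd_cons, hl.eq, List.length_cons]

theorem exists_isReduced_cons_of_isLeftDescent {k : I} {w : W} (h : cs.IsLeftDescent w k) :
    ∃ t, cs.IsReduced (k :: t) ∧ cs.wordProd (k :: t) = w := by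
  obtain ⟨t, ht, hwt⟩ := cs.exists_isReduced (cs.simple k * w)
  refine ⟨t, (isReduced_cons_iff_not_isLeftDescent ht).2 ?_, ?_⟩
  · rwa [← hwt, ← cs.isLeftDescent_iff_not_isLeftDescent_mul]
  · rw [cs.wordProd_cons, ← hwt, cs.simple_mul_simple_cancel_left]

theorem exists_isReduced_append_singleton {k : I} {l : List I} (hl : cs.IsReduced l)
    (h : ¬ cs.IsReduced (l ++ [k])) :
    ∃ t, cs.IsReduced (t ++ [k]) ∧ cs.wordProd (t ++ [k]) = cs.wordProd l := by
  have hdescent : cs.IsLeftDescent (cs.wordProd l.reverse) k := by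
    by_contra hk
    rw [← isReduced_cons_iff_not_isLeftDescent hl.reverse, ← cs.isReduced_reverse_iff] at hk
    exact h (by simpa using hk)
  obtain ⟨t, ht, htl⟩ := exists_isReduced_cons_of_isLeftDescent hdescent
  exact ⟨t.reverse, by simpa using ht.reverse, by
    rw [← inv_inj, ← cs.wordProd_reverse, ← cs.wordProd_reverse, ← htl]; simp⟩

theorem not_commutesToFront_of_isReduced_cons {k : I} {l : List I} (h : cs.IsReduced (k :: l)) :
    ¬ CommutesToFront M k l := by
  rintro ⟨u, v, rfl, hu⟩
  refine (isReduced_cons_iff_not_isLeftDescent (isReduced_of_cons h)).1 h ?_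
  rw [CoxeterSystem.IsLeftDescent, (isReduced_of_cons h).eq, wordProd_append_cons_of_commute hu,
    cs.wordProd_cons, cs.simple_mul_simple_cancel_left]
  exact (cs.length_wordProd_le _).trans_lt (by simp)

/-- The entry `-2 cos (π / m)` of the Gram matrix of a right-angled Coxeter group, as a function
of `m`, where `0` encodes `∞`; the value `0` at `m > 2` is a dummy. -/
def cartanEntry (m : ℕ) : ℤ := if m = 1 then 2 else if m = 0 then -2 else 0

variable (M) in
/-- The action of the `k`-th generator in the dual of the geometric representation, where a linear
form is recorded by its values at the simple roots. -/
def dualReflection (k : I) : Module.End ℤ (I → ℤ) :=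
  Module.preReflection (fun j => cartanEntry (M k j)) (LinearMap.proj k)

theorem dualReflection_apply (k : I) (v : I → ℤ) (j : I) :
    dualReflection M k v j = v j - v k * cartanEntry (M k j) := by
  simp [dualReflection, Module.preReflection_apply]

theorem dualReflection_mul_self (k : I) : dualReflection M k * dualReflection M k = 1 :=
  LinearMap.ext <| Module.involutive_preReflection (by simp [cartanEntry])

theorem commute_dualReflection {i j : I} (h : M i j = 2) :
    Commute (dualReflection M i) (dualReflection M j) := by
  refine LinearMap.ext fun v => funext fun k => ?_
  simp only [Module.End.mul_apply, dualReflection_apply, h, (M.symmetric j i).trans h]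
  simp [cartanEntry, sub_right_comm]

theorem isLiftable_dualReflection (hM : M.IsRightAngled) : M.IsLiftable (dualReflection M) := by
  intro i j
  obtain rfl | hij := eq_or_ne i j
  · rw [dualReflection_mul_self, one_pow]
  · obtain h | h := hM i j hij
    · rw [h, (commute_dualReflection h).mul_pow, pow_two, pow_two, dualReflection_mul_self,
        dualReflection_mul_self, one_mul]
    · rw [h, pow_zero]

/-- The dual of the geometric representation of a right-angled Coxeter group. -/
def dualRep (cs : CoxeterSystem M W) (hM : M.IsRightAngled) : W →* Module.End ℤ (I → ℤ) :=
  cs.lift ⟨dualReflection M, isLiftable_dualReflection hM⟩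

theorem dualRep_wordProd_cons (hM : M.IsRightAngled) (j : I) (l : List I) (v : I → ℤ) :
    dualRep cs hM (cs.wordProd (j :: l)) v =
      dualReflection M j (dualRep cs hM (cs.wordProd l) v) := by
  rw [cs.wordProd_cons, map_mul, dualRep, cs.lift_apply_simple (isLiftable_dualReflection hM),
    Module.End.mul_apply]

theorem cartanEntry_add_le_zero (hM : M.IsRightAngled) {a b : I} (hab : M a b = 0) (j : I) :
    cartanEntry (M j a) + cartanEntry (M j b) ≤ 0 := by
  have hba : M b a = 0 := (M.symmetric b a).trans hab
  have hle : ∀ c, j ≠ c → cartanEntry (M j c) ≤ 0 := fun c hc => by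
    obtain h | h := hM j c hc <;> simp [h, cartanEntry]
  obtain rfl | ha := eq_or_ne j a
  · simp [hab, cartanEntry]
  obtain rfl | hb := eq_or_ne j b
  · simp [hba, cartanEntry]
  · exact add_nonpos (hle a ha) (hle b hb)

-- The all-ones form lies inside the fundamental chamber, so the signs of its image under `w` tell
-- on which side of each simple wall `w` lies. The second conjunct says that the image stays
-- positive on the null root `α a + α b` of an infinite dihedral subgroup.
theorem dualRep_one_pos_iff (hM : M.IsRightAngled) {l : List I} (hl : cs.IsReduced l) :
    (∀ k, 0 < dualRep cs hM (cs.wordProd l) 1 k ↔ ¬ CommutesToFront M k l) ∧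
      ∀ a b, M a b = 0 →
        0 < dualRep cs hM (cs.wordProd l) 1 a + dualRep cs hM (cs.wordProd l) 1 b := by
  induction l with
  | nil => simp [not_commutesToFront_nil]
  | cons j l ih =>
    obtain ⟨hsign, hsum⟩ := ih (isReduced_of_cons hl)
    simp only [dualRep_wordProd_cons, dualReflection_apply]
    set v := dualRep cs hM (cs.wordProd l) 1
    have hj : 0 < v j := (hsign j).2 (not_commutesToFront_of_isReduced_cons hl)
    refine ⟨fun k => ?_, fun a b hab => ?_⟩
    · rw [commutesToFront_cons]
      obtain rfl | hkj := eq_or_ne k j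
      · simp only [M.diagonal, cartanEntry, if_true, true_or, not_true_eq_false, iff_false]
        linarith
      rw [M.symmetric j k]
      obtain h | h := hM k j hkj
      · simp [h, hkj, hsign, cartanEntry]
      · have := hsum k j h
        have hpos : v j * cartanEntry 0 < v k := by
          simp only [cartanEntry, zero_ne_one, if_false, if_true]
          linarith
        simp [h, hkj, hpos]
    · have := mul_nonpos_of_nonneg_of_nonpos hj.le (cartanEntry_add_le_zero hM hab j)
      linarith [hsum a b hab]

theorem isReduced_cons_iff (hM : M.IsRightAngled) {k : I} {l : List I} :
    cs.IsReduced (k :: l) ↔ cs.IsReduced l ∧ ¬ CommutesToFront M k l := by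
  refine ⟨fun h => ⟨isReduced_of_cons h, not_commutesToFront_of_isReduced_cons h⟩, ?_⟩
  rintro ⟨hl, hk⟩
  refine (isReduced_cons_iff_not_isLeftDescent hl).2 fun hdescent => ?_
  obtain ⟨t, ht, htl⟩ := exists_isReduced_cons_of_isLeftDescent hdescent
  rw [← (dualRep_one_pos_iff hM hl).1 k, ← htl, (dualRep_one_pos_iff hM ht).1 k] at hk
  exact hk (commutesToFront_cons.2 (.inl rfl))

theorem isReduced_pair (hM : M.IsRightAngled) {i j : I} (hij : i ≠ j) :
    cs.IsReduced [i, j] := by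
  rw [isReduced_cons_iff hM, commutesToFront_cons]
  exact ⟨isReduced_singleton j, by simp [hij, not_commutesToFront_nil]⟩

theorem isReduced_cons_cons_of_apply_eq_zero (hM : M.IsRightAngled) {i j : I} {l : List I}
    (hij : M i j = 0) (h : cs.IsReduced (j :: l)) : cs.IsReduced (i :: j :: l) := by
  rw [isReduced_cons_iff hM, commutesToFront_cons]
  exact ⟨h, by simp [ne_of_apply_eq_zero hij, hij]⟩

theorem eq_and_commute_of_not_isReduced (hM : M.IsRightAngled) {i k : I} {l : List I}
    (hil : cs.IsReduced (i :: l)) (hlk : cs.IsReduced (l ++ [k]))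
    (h : ¬ cs.IsReduced (i :: (l ++ [k]))) : i = k ∧ ∀ j ∈ l, M i j = 2 := by
  rw [isReduced_cons_iff hM, not_and, not_not] at h
  exact (h hlk).of_append_singleton (not_commutesToFront_of_isReduced_cons hil)

end RightAngled

/-! ### Galleries -/

namespace ChamberSystem

variable {I C : Type*} {S : ChamberSystem I C} {M : CoxeterMatrix I}

theorem hasGallery_nil_iff {x y : C} : S.HasGallery [] x y ↔ x = y :=
  ⟨fun h => by cases h; rfl, fun h => h ▸ .nil x⟩

theorem hasGallery_cons_iff {i : I} {f : List I} {x z : C} :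
    S.HasGallery (i :: f) x z ↔ ∃ y, S.adj i x y ∧ x ≠ y ∧ S.HasGallery f y z :=
  ⟨fun h => by cases h with | cons hxy hne h => exact ⟨_, hxy, hne, h⟩,
    fun ⟨_, hxy, hne, h⟩ => .cons hxy hne h⟩

theorem hasGallery_append_iff {f g : List I} {x z : C} :
    S.HasGallery (f ++ g) x z ↔ ∃ y, S.HasGallery f x y ∧ S.HasGallery g y z := by
  induction f generalizing x with
  | nil => simp [hasGallery_nil_iff]
  | cons i f ih => simp only [List.cons_append, hasGallery_cons_iff, ih]; aesop

theorem hasGallery_singleton_iff {i : I} {x y : C} :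
    S.HasGallery [i] x y ↔ S.adj i x y ∧ x ≠ y := by
  simp [hasGallery_cons_iff, hasGallery_nil_iff]

variable (S) in
/-- Two chambers are joined if they lie in the same connected component of the chamber system. -/
def Joined : C → C → Prop :=
  Relation.ReflTransGen fun x y => ∃ i, S.adj i x y

theorem Joined.symm {x y : C} (h : S.Joined x y) : S.Joined y x :=
  haveI : Std.Symm fun x y => ∃ i, S.adj i x y := ⟨fun _ _ ⟨i, hi⟩ => ⟨i, (S.adj i).symm hi⟩⟩
  Relation.ReflTransGen.stdSymm.symm _ _ h

theorem HasGallery.joined {f : List I} {x y : C} (h : S.HasGallery f x y) : S.Joined x y := by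
  induction h with
  | nil => exact .refl
  | cons hxy _ _ ih => exact ih.head ⟨_, hxy⟩

variable (S M) in
/-- Galleries of type `[i, j]` can be replaced by galleries of type `[j, i]` whenever `i` and `j`
commute. Unlike the building axioms, this passes to the fibre product of two buildings. -/
def HasCommutingSquares : Prop :=
  ∀ ⦃i j⦄, M i j = 2 → ∀ ⦃x y⦄, S.HasGallery [i, j] x y → S.HasGallery [j, i] x y

theorem HasCommutingSquares.hasGallery_cons (hS : S.HasCommutingSquares M) {k : I} {u v : List I}
    (hu : ∀ j ∈ u, M k j = 2) {x y : C} (h : S.HasGallery (u ++ k :: v) x y) :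
    S.HasGallery (k :: (u ++ v)) x y := by
  induction u generalizing x with
  | nil => exact h
  | cons j u ih =>
    rw [List.forall_mem_cons] at hu
    obtain ⟨x', hj, hne, h⟩ := hasGallery_cons_iff.1 h
    have hjk : S.HasGallery ([j, k] ++ (u ++ v)) x y := .cons hj hne (ih hu.2 h)
    obtain ⟨z, hz, huv⟩ := hasGallery_append_iff.1 hjk
    exact hasGallery_append_iff.2 ⟨z, hS ((M.symmetric j k).trans hu.1) hz, huv⟩

theorem HasCommutingSquares.exists_isReduced_hasGallery
    (hS : S.HasCommutingSquares M) (hM : M.IsRightAngled) {x y : C} (h : S.Joined x y) :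
    ∃ f, M.toCoxeterSystem.IsReduced f ∧ S.HasGallery f x y := by
  induction h using Relation.ReflTransGen.head_induction_on with
  | refl => exact ⟨[], by simp [CoxeterSystem.IsReduced], .nil y⟩
  | @head x z hxz _ ih =>
    obtain ⟨i, hi⟩ := hxz
    obtain ⟨g, hg, hzy⟩ := ih
    obtain rfl | hne := eq_or_ne x z
    · exact ⟨g, hg, hzy⟩
    by_cases hig : RightAngled.CommutesToFront M i g
    · obtain ⟨u, v, rfl, hu⟩ := hig
      have hiuv : M.toCoxeterSystem.IsReduced (i :: (u ++ v)) :=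
        RightAngled.isReduced_of_wordProd_eq hg
          (RightAngled.wordProd_append_cons_of_commute hu v) (by simp +arith)
      obtain ⟨z', hzz', -, hz'y⟩ := hasGallery_cons_iff.1 (hS.hasGallery_cons hu hzy)
      obtain rfl | hne' := eq_or_ne x z'
      · exact ⟨_, RightAngled.isReduced_of_cons hiuv, hz'y⟩
      · exact ⟨_, hiuv, .cons ((S.adj i).trans hi hzz') hne' hz'y⟩
    · exact ⟨i :: g, (RightAngled.isReduced_cons_iff hM).2 ⟨hg, hig⟩, .cons hi hne hzy⟩

namespace IsBuilding

variable {f g : List I} {x y : C}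

theorem exists_isReduced_hasGallery (hS : S.IsBuilding M) (x y : C) :
    ∃ f, M.toCoxeterSystem.IsReduced f ∧ S.HasGallery f x y := by
  obtain ⟨δ, hδ⟩ := hS.2
  obtain ⟨f, hf, hxy⟩ := M.toCoxeterSystem.exists_isReduced (δ x y)
  exact ⟨f, hf, (hδ x y f hf).1 hxy⟩

theorem joined (hS : S.IsBuilding M) (x y : C) : S.Joined x y :=
  let ⟨_, _, h⟩ := hS.exists_isReduced_hasGallery x y
  h.joined

theorem wordProd_eq (hS : S.IsBuilding M) (hf : M.toCoxeterSystem.IsReduced f)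
    (hg : M.toCoxeterSystem.IsReduced g) (hfxy : S.HasGallery f x y)
    (hgxy : S.HasGallery g x y) : M.toCoxeterSystem.wordProd f = M.toCoxeterSystem.wordProd g := by
  obtain ⟨δ, hδ⟩ := hS.2
  exact ((hδ x y f hf).2 hfxy).symm.trans ((hδ x y g hg).2 hgxy)

theorem hasGallery_of_wordProd_eq (hS : S.IsBuilding M) (hf : M.toCoxeterSystem.IsReduced f)
    (hg : M.toCoxeterSystem.IsReduced g)
    (hfg : M.toCoxeterSystem.wordProd f = M.toCoxeterSystem.wordProd g)
    (h : S.HasGallery f x y) : S.HasGallery g x y := by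
  obtain ⟨δ, hδ⟩ := hS.2
  exact (hδ x y g hg).1 (((hδ x y f hf).2 h).trans hfg)

theorem eq_nil_of_hasGallery_self (hS : S.IsBuilding M) (hf : M.toCoxeterSystem.IsReduced f)
    (h : S.HasGallery f x x) : f = [] := by
  have hnil : M.toCoxeterSystem.IsReduced [] := by simp [CoxeterSystem.IsReduced]
  rw [← List.length_eq_zero_iff, ← hf.eq, hS.wordProd_eq hf hnil h (.nil x), hnil.eq,
    List.length_nil]

theorem hasCommutingSquares (hS : S.IsBuilding M) (hM : M.IsRightAngled) :
    S.HasCommutingSquares M := by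
  intro i j hij x y h
  have hne := RightAngled.ne_of_apply_eq_two hij
  refine hS.hasGallery_of_wordProd_eq (RightAngled.isReduced_pair hM hne)
    (RightAngled.isReduced_pair hM hne.symm) ?_ h
  simp only [M.toCoxeterSystem.wordProd_cons, M.toCoxeterSystem.wordProd_nil, mul_one]
  exact RightAngled.commute_simple hij

end IsBuilding

theorem panelOf_eq {i : I} {P : S.Panel i} {c : C} (hc : c ∈ P.1) : S.panelOf i c = P :=
  Subtype.ext <| Setoid.eq_of_mem_classes (Setoid.mem_classes _ c) ((S.adj i).refl c) P.2 hc

end ChamberSystem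

/-! ### Legal colourings -/

namespace ChamberSystem.LegalColouring

variable {I C C' C'' : Type*} {M : CoxeterMatrix I} {X : I → Type*}
variable {S : ChamberSystem I C} {S' : ChamberSystem I C'} {S'' : ChamberSystem I C''}
variable {col : S.LegalColouring X} {col' : S'.LegalColouring X} {col'' : S''.LegalColouring X}

theorem apply_eq_of_adj (col : S.LegalColouring X) {i j : I} (hj : j ≠ i) {c d : C}
    (h : S.adj i c d) : col.toFun c j = col.toFun d j :=
  col.const i (S.panelOf i d) j hj c h d ((S.adj i).refl d)

theorem eq_of_adj (col : S.LegalColouring X) {i : I} {c d : C} (h : S.adj i c d)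
    (hcol : col.toFun c i = col.toFun d i) : c = d :=
  (col.bijOn i (S.panelOf i d)).injOn h ((S.adj i).refl d) hcol

theorem exists_adj_apply_eq (col : S.LegalColouring X) (i : I) (x : X i) (c : C) :
    ∃ d, S.adj i c d ∧ col.toFun d i = x := by
  obtain ⟨d, hd, hx⟩ := (col.bijOn i (S.panelOf i c)).surjOn (Set.mem_univ x)
  exact ⟨d, (S.adj i).symm hd, hx⟩

variable (col col') in
/-- The fibre product of two coloured chamber systems over the set of colours. Its galleries are
the pairs of galleries along which both colourings agree. -/
def fiberProd : ChamberSystem I (Function.Pullback col.toFun col'.toFun) where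
  adj i := (S.adj i).comap (·.fst) ⊓ (S'.adj i).comap (·.snd)

theorem toFun_fst (p : Function.Pullback col.toFun col'.toFun) :
    col.toFun p.fst = col'.toFun p.snd :=
  p.2

theorem fst_eq_iff_snd_eq_of_adj {i : I} {p q : Function.Pullback col.toFun col'.toFun}
    (h : (fiberProd col col').adj i p q) : p.fst = q.fst ↔ p.snd = q.snd :=
  ⟨fun hpq => col'.eq_of_adj h.2 (by rw [← toFun_fst, ← toFun_fst, hpq]),
    fun hpq => col.eq_of_adj h.1 (by rw [toFun_fst, toFun_fst, hpq])⟩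

theorem hasGallery_fst {f : List I} {p q : Function.Pullback col.toFun col'.toFun}
    (h : (fiberProd col col').HasGallery f p q) : S.HasGallery f p.fst q.fst := by
  induction h with
  | nil p => exact .nil _
  | cons hadj hne _ ih =>
    refine .cons hadj.1 (fun hfst => hne ?_) ih
    exact Subtype.ext (Prod.ext hfst ((fst_eq_iff_snd_eq_of_adj hadj).1 hfst))

theorem hasGallery_snd {f : List I} {p q : Function.Pullback col.toFun col'.toFun}
    (h : (fiberProd col col').HasGallery f p q) : S'.HasGallery f p.snd q.snd := by
  induction h with
  | nil p => exact .nil _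
  | cons hadj hne _ ih =>
    refine .cons hadj.2 (fun hsnd => hne ?_) ih
    exact Subtype.ext (Prod.ext ((fst_eq_iff_snd_eq_of_adj hadj).2 hsnd) hsnd)

theorem hasCommutingSquares_fiberProd (hS : S.HasCommutingSquares M)
    (hS' : S'.HasCommutingSquares M) : (fiberProd col col').HasCommutingSquares M := by
  intro i j hij p q h
  have hne := RightAngled.ne_of_apply_eq_two hij
  obtain ⟨a, hpa, hpa_ne, haq⟩ := hasGallery_cons_iff.1 (hS hij (hasGallery_fst h))
  obtain ⟨b, hpb, -, hbq⟩ := hasGallery_cons_iff.1 (hS' hij (hasGallery_snd h))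
  rw [hasGallery_singleton_iff] at haq hbq
  have hab : col.toFun a = col'.toFun b := funext fun k => by
    obtain rfl | hk := eq_or_ne k i
    · rw [← col.apply_eq_of_adj hne hpa, ← col'.apply_eq_of_adj hne hpb]
      exact congrFun (toFun_fst p) k
    · rw [col.apply_eq_of_adj hk haq.1, col'.apply_eq_of_adj hk hbq.1]
      exact congrFun (toFun_fst q) k
  refine .cons (y := ⟨(a, b), hab⟩) ⟨hpa, hpb⟩ (fun h => hpa_ne (congrArg (·.fst) h)) ?_
  exact hasGallery_singleton_iff.2 ⟨⟨haq.1, hbq.1⟩, fun h => haq.2 (congrArg (·.fst) h)⟩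

theorem eq_of_fst_eq_of_joined (hS : S.IsBuilding M) (hS' : S'.HasCommutingSquares M)
    (hM : M.IsRightAngled) {p q : Function.Pullback col.toFun col'.toFun}
    (h : (fiberProd col col').Joined p q) (hpq : p.fst = q.fst) : p = q := by
  obtain ⟨f, hf, hgal⟩ :=
    (hasCommutingSquares_fiberProd (hS.hasCommutingSquares hM) hS').exists_isReduced_hasGallery hM h
  have hclosed : S.HasGallery f p.fst p.fst := by
    simpa only [← hpq] using hasGallery_fst hgal
  rw [hS.eq_nil_of_hasGallery_self hf hclosed] at hgal
  exact hasGallery_nil_iff.1 hgal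

theorem exists_adj_fst_eq (p : Function.Pullback col.toFun col'.toFun) {i : I} {d : C}
    (h : S.adj i p.fst d) : ∃ q, (fiberProd col col').adj i p q ∧ q.fst = d := by
  obtain ⟨d', hadj, hd'⟩ := col'.exists_adj_apply_eq i (col.toFun d i) p.snd
  have hcol : col.toFun d = col'.toFun d' := funext fun k => by
    obtain rfl | hk := eq_or_ne k i
    · exact hd'.symm
    · rw [← col.apply_eq_of_adj hk h, ← col'.apply_eq_of_adj hk hadj]
      exact congrFun (toFun_fst p) k
  exact ⟨⟨(d, d'), hcol⟩, ⟨h, hadj⟩, rfl⟩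

theorem exists_joined_fst_eq (p : Function.Pullback col.toFun col'.toFun) {d : C}
    (h : S.Joined p.fst d) : ∃ q, (fiberProd col col').Joined p q ∧ q.fst = d := by
  induction h with
  | refl => exact ⟨p, .refl, rfl⟩
  | tail _ hadj ih =>
    obtain ⟨i, hi⟩ := hadj
    obtain ⟨q, hpq, rfl⟩ := ih
    obtain ⟨r, hqr, rfl⟩ := exists_adj_fst_eq q hi
    exact ⟨r, hpq.tail ⟨i, hqr⟩, rfl⟩

variable (col col') in
/-- Colour-preserving morphisms of chamber systems. -/
structure IsHom (φ : C → C') : Prop where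
  adj {i : I} {c d : C} : S.adj i c d → S'.adj i (φ c) (φ d)
  apply_eq (c : C) : col'.toFun (φ c) = col.toFun c

theorem IsHom.id : IsHom col col id :=
  ⟨fun h => h, fun _ => rfl⟩

theorem IsHom.comp {ψ : C' → C''} {φ : C → C'} (hψ : IsHom col' col'' ψ) (hφ : IsHom col col' φ) :
    IsHom col col'' (ψ ∘ φ) :=
  ⟨fun h => hψ.adj (hφ.adj h), fun c => (hψ.apply_eq _).trans (hφ.apply_eq c)⟩

theorem IsHom.eq_of_joined {φ ψ : C → C'} (hφ : IsHom col col' φ) (hψ : IsHom col col' ψ)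
    {c d : C} (hc : φ c = ψ c) (h : S.Joined c d) : φ d = ψ d := by
  induction h with
  | refl => exact hc
  | @tail d e _ hadj ih =>
    obtain ⟨i, hi⟩ := hadj
    refine col'.eq_of_adj (i := i) ?_ (by rw [hφ.apply_eq, hψ.apply_eq])
    exact (S'.adj i).trans ((S'.adj i).symm (hφ.adj hi)) (ih ▸ hψ.adj hi)

theorem exists_isHom (hS : S.IsBuilding M) (hS' : S'.HasCommutingSquares M)
    (hM : M.IsRightAngled) {c : C} {c' : C'} (h : col.toFun c = col'.toFun c') :
    ∃ φ, IsHom col col' φ ∧ φ c = c' := by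
  let p : Function.Pullback col.toFun col'.toFun := ⟨(c, c'), h⟩
  choose q hpq hq using fun d => exists_joined_fst_eq p (hS.joined c d)
  have huniq {d r} (hpr : (fiberProd col col').Joined p r) (hr : r.fst = d) : r = q d :=
    eq_of_fst_eq_of_joined hS hS' hM (hpr.symm.trans (hpq d)) (hr.trans (hq d).symm)
  refine ⟨fun d => (q d).snd, ⟨fun {i d e} hde => ?_, fun d => ?_⟩, ?_⟩
  · obtain ⟨r, hdr, hr⟩ := exists_adj_fst_eq (q d) ((hq d).symm ▸ hde)
    exact huniq ((hpq d).tail ⟨i, hdr⟩) hr ▸ hdr.2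
  · exact (toFun_fst (q d)).symm.trans (congrArg col.toFun (hq d))
  · exact congrArg (·.snd) (huniq .refl rfl).symm

theorem exists_equiv (hS : S.IsBuilding M) (hS' : S'.IsBuilding M) (hM : M.IsRightAngled)
    {c : C} {c' : C'} (h : col.toFun c = col'.toFun c') :
    ∃ φ : C ≃ C', (∀ i d e, S'.adj i (φ d) (φ e) ↔ S.adj i d e) ∧
      (∀ d, col'.toFun (φ d) = col.toFun d) ∧ φ c = c' := by
  obtain ⟨φ, hφ, hφc⟩ := exists_isHom hS (hS'.hasCommutingSquares hM) hM h
  obtain ⟨ψ, hψ, hψc⟩ := exists_isHom hS' (hS.hasCommutingSquares hM) hM h.symm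
  have hψφ : Function.LeftInverse ψ φ := fun d =>
    (hψ.comp hφ).eq_of_joined .id (by simp [hφc, hψc]) (hS.joined c d)
  have hφψ : Function.RightInverse ψ φ := fun d =>
    (hφ.comp hψ).eq_of_joined .id (by simp [hφc, hψc]) (hS'.joined c' d)
  have hadj i d e : S'.adj i (φ d) (φ e) ↔ S.adj i d e :=
    ⟨fun h => by simpa only [hψφ d, hψφ e] using hψ.adj h, hφ.adj⟩
  exact ⟨⟨φ, ψ, hψφ, hφψ⟩, hadj, hφ.apply_eq, hφc⟩

/-- The legal colouring obtained by permuting the colours on each panel. -/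
def permute (col : S.LegalColouring X) (p : ∀ i, S.Panel i → Equiv.Perm (X i))
    (hp : ∀ i j, j ≠ i → ∀ c d, S.adj i c d →
      p j (S.panelOf j c) (col.toFun c j) = p j (S.panelOf j d) (col.toFun d j)) :
    S.LegalColouring X where
  toFun c i := p i (S.panelOf i c) (col.toFun c i)
  bijOn i P := ((p i P).bijective.bijOn_univ.comp (col.bijOn i P)).congr fun c hc => by
    simp only [Function.comp_apply, panelOf_eq hc]
  const i P j hj c hc d hd := hp i j hj c d <| by
    obtain ⟨e, he⟩ := P.2
    rw [he] at hc hd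
    exact (S.adj i).trans hc ((S.adj i).symm hd)

theorem exists_localAction_eq (hS : S.IsBuilding M) (hM : M.IsRightAngled)
    (p : ∀ i, S.Panel i → Equiv.Perm (X i))
    (hp : ∀ i j, j ≠ i → ∀ c d, S.adj i c d →
      p j (S.panelOf j c) (col.toFun c j) = p j (S.panelOf j d) (col.toFun d j))
    {c : C} (hc : ∀ i, p i (S.panelOf i c) (col.toFun c i) = col.toFun c i) :
    ∃ g : S.autGroup, g.1 c = c ∧ ∀ i (P : S.Panel i), col.localAction g P = p i P := by
  obtain ⟨g, hg, hcol, hgc⟩ := exists_equiv (col := col.permute p hp) (col' := col) hS hS hM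
    (c := c) (c' := c) (funext hc)
  refine ⟨⟨g, hg⟩, hgc, fun i P => col.localAction_eq _ _ _ fun d hd => ?_⟩
  rw [hcol]
  simp only [permute, panelOf_eq hd]

end ChamberSystem.LegalColouring

/-! ### Wings -/

namespace ChamberSystem

variable {I C : Type*} {S : ChamberSystem I C} {M : CoxeterMatrix I} {i j k : I} {c c' d d' e : C}

theorem IsBuilding.exists_adj_ne (hS : S.IsBuilding M) (i : I) (c : C) :
    ∃ d, S.adj i c d ∧ c ≠ d := by
  obtain ⟨d, hd, hne⟩ := (hS.1 i (S.panelOf i c)).exists_ne c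
  exact ⟨d, (S.adj i).symm hd, hne.symm⟩

variable (S M) in
/-- The `i`-wing of `c`: the chambers whose projection to the `i`-panel of `c` is `c`. It is encoded
by galleries from `c` of a reduced type which stays reduced when `i` is put in front. -/
def wing (i : I) (c : C) : Set C :=
  {d | ∃ f, M.toCoxeterSystem.IsReduced (i :: f) ∧ S.HasGallery f c d}

variable (S M) in
theorem self_mem_wing (i : I) (c : C) : c ∈ S.wing M i c :=
  ⟨[], RightAngled.isReduced_singleton i, .nil c⟩

theorem notMem_wing_of_adj (hS : S.IsBuilding M) (hcd : S.adj i c d) (hne : c ≠ d) :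
    d ∉ S.wing M i c := by
  rintro ⟨f, hf, h⟩
  have hloop : S.HasGallery (i :: f) d d := .cons ((S.adj i).symm hcd) hne.symm h
  exact List.cons_ne_nil i f (hS.eq_nil_of_hasGallery_self hf hloop)

theorem wing_induction {p : C → Prop} (base : p c)
    (step : ∀ ⦃d⦄, d ∈ S.wing M i c → ∀ ⦃e⦄, e ∈ S.wing M i c →
      ∀ ⦃k⦄, S.adj k d e → p d → p e) (hd : d ∈ S.wing M i c) : p d := by
  obtain ⟨f, hf, h⟩ := hd
  induction f using List.reverseRecOn generalizing d with
  | nil => exact hasGallery_nil_iff.1 h ▸ base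
  | append_singleton f k ih =>
    obtain ⟨y, hy, hyd⟩ := hasGallery_append_iff.1 h
    have hf' : M.toCoxeterSystem.IsReduced (i :: f) :=
      RightAngled.isReduced_of_append (t := [k]) hf
    exact step ⟨f, hf', hy⟩ ⟨_, hf, h⟩ (hasGallery_singleton_iff.1 hyd).1 (ih hf' hy)

theorem eq_and_commute_of_notMem_wing (hS : S.IsBuilding M) (hM : M.IsRightAngled) {f : List I}
    (hf : M.toCoxeterSystem.IsReduced (i :: f)) (h : S.HasGallery f c d) (hde : S.adj k d e)
    (he : e ∉ S.wing M i c) : i = k ∧ ∀ j ∈ f, M i j = 2 := by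
  have hf' := RightAngled.isReduced_of_cons hf
  have hne : d ≠ e := by
    rintro rfl
    exact he ⟨f, hf, h⟩
  by_cases hfk : M.toCoxeterSystem.IsReduced (f ++ [k])
  · refine RightAngled.eq_and_commute_of_not_isReduced hM hf hfk fun hifk => he ⟨_, hifk, ?_⟩
    exact hasGallery_append_iff.2 ⟨d, h, hasGallery_singleton_iff.2 ⟨hde, hne⟩⟩
  exfalso
  obtain ⟨t, ht, htf⟩ := RightAngled.exists_isReduced_append_singleton hf' hfk
  have hit : M.toCoxeterSystem.IsReduced (i :: (t ++ [k])) := by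
    refine RightAngled.isReduced_of_wordProd_eq hf ?_ ?_
    · rw [M.toCoxeterSystem.wordProd_cons, M.toCoxeterSystem.wordProd_cons, htf]
    · rw [List.length_cons, List.length_cons, ← hf'.eq, ← ht.eq, htf]
  obtain ⟨y, hcy, hyd⟩ := hasGallery_append_iff.1 (hS.hasGallery_of_wordProd_eq hf' ht htf.symm h)
  have hye : S.adj k y e := (S.adj k).trans (hasGallery_singleton_iff.1 hyd).1 hde
  obtain rfl | hne' := eq_or_ne y e
  · exact he ⟨t, RightAngled.isReduced_of_append (t := [k]) hit, hcy⟩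
  · exact he ⟨_, hit, hasGallery_append_iff.2 ⟨y, hcy, hasGallery_singleton_iff.2 ⟨hye, hne'⟩⟩⟩

theorem mem_wing_of_adj (hS : S.IsBuilding M) (hM : M.IsRightAngled) (hk : k ≠ i)
    (hd : d ∈ S.wing M i c) (hde : S.adj k d e) : e ∈ S.wing M i c := by
  obtain ⟨f, hf, h⟩ := hd
  by_contra he
  exact hk (eq_and_commute_of_notMem_wing hS hM hf h hde he).1.symm

theorem mem_wing_iff_of_adj (hS : S.IsBuilding M) (hM : M.IsRightAngled) (hk : k ≠ i)
    (hde : S.adj k d e) : d ∈ S.wing M i c ↔ e ∈ S.wing M i c :=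
  ⟨fun hd => mem_wing_of_adj hS hM hk hd hde,
    fun he => mem_wing_of_adj hS hM hk he ((S.adj k).symm hde)⟩

theorem hasGallery_and_isReduced_of_adj_of_adj (hM : M.IsRightAngled) (hij : M i j = 0)
    (hcc' : S.adj i c c') (hne : c ≠ c') (hc'e : S.adj j c' e) (hne' : c' ≠ e) {f : List I}
    (hf : M.toCoxeterSystem.IsReduced (i :: f)) (h : S.HasGallery f c d) :
    S.HasGallery (j :: i :: f) e d ∧ M.toCoxeterSystem.IsReduced (i :: j :: i :: f) :=
  ⟨.cons ((S.adj j).symm hc'e) hne'.symm (.cons ((S.adj i).symm hcc') hne.symm h),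
    RightAngled.isReduced_cons_cons_of_apply_eq_zero hM hij <|
      RightAngled.isReduced_cons_cons_of_apply_eq_zero hM ((M.symmetric j i).trans hij) hf⟩

theorem wing_subset_of_adj_of_adj (hM : M.IsRightAngled) (hij : M i j = 0)
    (hcc' : S.adj i c c') (hne : c ≠ c') (hc'e : S.adj j c' e) (hne' : c' ≠ e) :
    S.wing M i c ⊆ S.wing M i e := by
  rintro d ⟨f, hf, h⟩
  have ⟨h', hf'⟩ := hasGallery_and_isReduced_of_adj_of_adj hM hij hcc' hne hc'e hne' hf h
  exact ⟨_, hf', h'⟩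

theorem mem_wing_of_adj_of_adj (hS : S.IsBuilding M) (hM : M.IsRightAngled) (hij : M i j = 0)
    (hcc' : S.adj i c c') (hne : c ≠ c') (hc'e : S.adj j c' e) (hne' : c' ≠ e)
    (hd : d ∈ S.wing M i c) (hdd' : S.adj k d d') : d' ∈ S.wing M i e := by
  obtain ⟨f, hf, h⟩ := hd
  have ⟨h', hf'⟩ := hasGallery_and_isReduced_of_adj_of_adj hM hij hcc' hne hc'e hne' hf h
  by_contra hd'
  have := (eq_and_commute_of_notMem_wing hS hM hf' h' hdd' hd').2 j (by simp)
  omega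

theorem exists_wing_supset_mem (hS : S.IsBuilding M) (hM : M.IsRightAngled) (hij : M i j = 0)
    (c d : C) : ∃ e, S.wing M i c ⊆ S.wing M i e ∧ d ∈ S.wing M i e := by
  induction hS.joined c d with
  | refl => exact ⟨c, subset_rfl, S.self_mem_wing M i c⟩
  | tail _ hadj ih =>
    obtain ⟨k, hk⟩ := hadj
    obtain ⟨e, hce, hde⟩ := ih
    obtain ⟨e', hee', hne⟩ := hS.exists_adj_ne i e
    obtain ⟨e'', he'e'', hne'⟩ := hS.exists_adj_ne j e'
    exact ⟨e'', hce.trans (wing_subset_of_adj_of_adj hM hij hee' hne he'e'' hne'),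
      mem_wing_of_adj_of_adj hS hM hij hee' hne he'e'' hne' hde hk⟩

theorem exists_finset_subset_wing [Nonempty C] (hS : S.IsBuilding M) (hM : M.IsRightAngled)
    (hij : M i j = 0) (Φ : Finset C) : ∃ c, ↑Φ ⊆ S.wing M i c := by
  classical
  induction Φ using Finset.induction_on with
  | empty => exact ⟨Classical.arbitrary C, by simp⟩
  | insert d Φ _ ih =>
    obtain ⟨c, hc⟩ := ih
    obtain ⟨e, hce, hde⟩ := exists_wing_supset_mem hS hM hij c d
    exact ⟨e, by simpa [Set.insert_subset_iff] using ⟨hde, hc.trans hce⟩⟩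

end ChamberSystem

namespace ChamberSystem.LegalColouring

variable {I C : Type*} {M : CoxeterMatrix I} {X : I → Type*} {S : ChamberSystem I C}
variable {col : S.LegalColouring X} {F : ∀ i, Subgroup (Equiv.Perm (X i))} {i j k : I} {c d e : C}

theorem apply_eq_of_hasGallery (col : S.LegalColouring X) {f : List I} (hi : i ∉ f)
    (h : S.HasGallery f c d) : col.toFun c i = col.toFun d i := by
  induction h with
  | nil => rfl
  | cons hadj _ _ ih =>
    rw [List.mem_cons, not_or] at hi
    exact (col.apply_eq_of_adj hi.1 hadj).trans (ih hi.2)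

theorem apply_eq_of_notMem_wing (col : S.LegalColouring X) (hS : S.IsBuilding M)
    (hM : M.IsRightAngled) (hd : d ∈ S.wing M i c) (hde : S.adj k d e)
    (he : e ∉ S.wing M i c) : col.toFun d i = col.toFun c i := by
  obtain ⟨f, hf, h⟩ := hd
  have hcomm := (eq_and_commute_of_notMem_wing hS hM hf h hde he).2
  exact (col.apply_eq_of_hasGallery (fun hi => by simpa using hcomm i hi) h).symm

theorem exists_finset_subset_wing_apply_eq [Nonempty C] (col : S.LegalColouring X)
    (hS : S.IsBuilding M) (hM : M.IsRightAngled) (hij : M i j = 0) (Φ : Finset C) (x : X i) :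
    ∃ c, col.toFun c i = x ∧ ↑Φ ⊆ S.wing M i c := by
  obtain ⟨c, hc⟩ := exists_finset_subset_wing hS hM hij Φ
  obtain ⟨c', hcc', rfl⟩ := col.exists_adj_apply_eq i x c
  obtain rfl | hne := eq_or_ne c c'
  · exact ⟨c, rfl, hc⟩
  obtain ⟨e, hc'e, hne'⟩ := hS.exists_adj_ne j c'
  exact ⟨e, (col.apply_eq_of_adj (RightAngled.ne_of_apply_eq_zero hij) hc'e).symm,
    hc.trans (wing_subset_of_adj_of_adj hM hij hcc' hne hc'e hne')⟩

open Classical in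
variable (M S) in
/-- Panelwise permutations of the colours which are trivial except on the `i`-panels not contained
in the `i`-wing of `c`, where they are `f`. -/
noncomputable def wingPerm (i : I) (c : C) (f : Equiv.Perm (X i)) :
    ∀ k, S.Panel k → Equiv.Perm (X k) :=
  Function.update 1 i fun P => if P.1 ⊆ S.wing M i c then 1 else f

open Classical in
theorem wingPerm_of_ne (hk : k ≠ i) (f : Equiv.Perm (X i)) (P : S.Panel k) :
    wingPerm M S i c f k P = 1 := by
  rw [wingPerm, Function.update_of_ne hk, Pi.one_apply, Pi.one_apply]

open Classical in
theorem wingPerm_self (f : Equiv.Perm (X i)) (P : S.Panel i) :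
    wingPerm M S i c f i P = if P.1 ⊆ S.wing M i c then 1 else f := by
  rw [wingPerm, Function.update_self]

theorem wingPerm_panelOf_eq (hde : S.adj i d e) (he : e ∉ S.wing M i c) (f : Equiv.Perm (X i)) :
    wingPerm M S i c f i (S.panelOf i d) = f := by
  rw [wingPerm_self, if_neg fun h => he (h ((S.adj i).symm hde))]

theorem wingPerm_mem {f : Equiv.Perm (X i)} (hf : f ∈ F i) (k : I) (P : S.Panel k) :
    wingPerm M S i c f k P ∈ F k := by
  classical
  obtain rfl | hk := eq_or_ne k i
  · rw [wingPerm_self]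
    split_ifs
    exacts [one_mem _, hf]
  · rw [wingPerm_of_ne hk]
    exact one_mem _

theorem wingPerm_apply_of_mem_wing (hS : S.IsBuilding M) (hM : M.IsRightAngled)
    {f : Equiv.Perm (X i)} (hfc : f (col.toFun c i) = col.toFun c i) (hd : d ∈ S.wing M i c)
    (k : I) : wingPerm M S i c f k (S.panelOf k d) (col.toFun d k) = col.toFun d k := by
  classical
  obtain rfl | hk := eq_or_ne k i
  · rw [wingPerm_self]
    split_ifs with hsub
    · rfl
    · obtain ⟨e, hed, he⟩ := Set.not_subset.1 hsub
      rwa [col.apply_eq_of_notMem_wing hS hM hd ((S.adj k).symm hed) he]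
  · rw [wingPerm_of_ne hk, Equiv.Perm.one_apply]

theorem wingPerm_apply_eq_of_adj (hS : S.IsBuilding M) (hM : M.IsRightAngled)
    {f : Equiv.Perm (X i)} (hfc : f (col.toFun c i) = col.toFun c i) (hjk : j ≠ k)
    (hde : S.adj k d e) :
    wingPerm M S i c f j (S.panelOf j d) (col.toFun d j) =
      wingPerm M S i c f j (S.panelOf j e) (col.toFun e j) := by
  have hcol := col.apply_eq_of_adj hjk hde
  obtain rfl | hj := eq_or_ne j i
  · have hiff := mem_wing_iff_of_adj (c := c) hS hM hjk.symm hde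
    by_cases hd : d ∈ S.wing M j c
    · rwa [wingPerm_apply_of_mem_wing hS hM hfc hd,
        wingPerm_apply_of_mem_wing hS hM hfc (hiff.1 hd)]
    · rw [wingPerm_panelOf_eq ((S.adj j).refl d) hd,
        wingPerm_panelOf_eq ((S.adj j).refl e) (hiff.not.1 hd), hcol]
  · rw [wingPerm_of_ne hj, wingPerm_of_ne hj, Equiv.Perm.one_apply, Equiv.Perm.one_apply, hcol]

theorem exists_ne_one_fixing_wing (hS : S.IsBuilding M) (hM : M.IsRightAngled)
    {f : Equiv.Perm (X i)} (hf : f ∈ F i) (hf_ne : f ≠ 1)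
    (hfc : f (col.toFun c i) = col.toFun c i) :
    ∃ g ∈ col.universalGroup F, g ≠ 1 ∧ ∀ d ∈ S.wing M i c, g d = d := by
  obtain ⟨g, hgc, hloc⟩ := col.exists_localAction_eq hS hM (wingPerm M S i c f)
    (fun _ _ hjk _ _ hde => wingPerm_apply_eq_of_adj hS hM hfc hjk hde)
    (wingPerm_apply_of_mem_wing hS hM hfc (S.self_mem_wing M i c))
  refine ⟨g.1, ⟨g.2, fun k P => hloc k P ▸ wingPerm_mem hf k P⟩, fun hg => hf_ne ?_, ?_⟩
  · obtain ⟨e, hce, hne⟩ := hS.exists_adj_ne i c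
    obtain rfl : g = 1 := Subtype.ext hg
    rw [← wingPerm_panelOf_eq hce (notMem_wing_of_adj hS hce hne) f, ← hloc, localAction_one]
  · refine fun d hd => wing_induction (p := fun d => g.1 d = d) hgc ?_ hd
    intro d _ e he k hde hd
    have hge : S.adj k (g.1 e) e :=
      (S.adj k).trans ((S.adj k).symm ((g.2 k d e).2 hde)) (hd.symm ▸ hde)
    refine col.eq_of_adj hge ?_
    rw [← col.localAction_apply g (S.panelOf k e) ((S.adj k).refl e), hloc,
      wingPerm_apply_of_mem_wing hS hM hfc he]

theorem isCancelSMul_of_forall_exists_wing (col : S.LegalColouring X) (hS : S.IsBuilding M)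
    (hM : M.IsRightAngled) (h : ∀ x, ∃ c, col.toFun c i = x ∧
      ∀ g ∈ col.universalGroup F, (∀ d ∈ S.wing M i c, g d = d) → g = 1) :
    IsCancelSMul (F i) (X i) := by
  refine isCancelSMul_iff_eq_one_of_smul_eq.2 fun f x hfx => ?_
  obtain ⟨c, rfl, hc⟩ := h x
  by_contra hf
  obtain ⟨g, hgF, hg_ne, hg⟩ :=
    exists_ne_one_fixing_wing hS hM f.2 (fun h => hf (Subtype.ext h)) hfx
  exact hg_ne (hc g hgF hg)

end ChamberSystem.LegalColouring

/-! ### Discreteness -/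

theorem discreteTopology_permutationTopology_iff {X : Type*} {G : Subgroup (Equiv.Perm X)} :
    @DiscreteTopology G (permutationTopology G) ↔
      ∃ Φ : Finset X, ∀ g ∈ G, (∀ x ∈ Φ, g x = x) → g = 1 := by
  let _ := permutationTopology G
  have : IsTopologicalGroup G := (permutationBasis G).isTopologicalGroup
  rw [discreteTopology_iff_isOpen_singleton_one, isOpen_iff_mem_nhds]
  simp only [Set.mem_singleton_iff, forall_eq]
  rw [(permutationBasis G).nhds_one_hasBasis.mem_iff]
  constructor
  · rintro ⟨_, ⟨Φ, rfl⟩, h⟩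
    refine ⟨Φ, fun g hg hfix => ?_⟩
    exact congrArg Subtype.val (h (a := ⟨g, hg⟩) ((mem_fixingSubgroup_iff G).2 hfix))
  · rintro ⟨Φ, h⟩
    exact ⟨_, ⟨Φ, rfl⟩, fun g hg => Subtype.ext (h g.1 g.2 ((mem_fixingSubgroup_iff G).1 hg))⟩

theorem discreteTopology_permutationTopology_of_isCancelSMul {X : Type*} [Nonempty X]
    {G : Subgroup (Equiv.Perm X)} (h : IsCancelSMul G X) :
    @DiscreteTopology G (permutationTopology G) := by
  obtain ⟨x⟩ := ‹Nonempty X›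
  refine discreteTopology_permutationTopology_iff.2 ⟨{x}, fun g hg hx => ?_⟩
  exact congrArg Subtype.val
    (isCancelSMul_iff_eq_one_of_smul_eq.1 h ⟨g, hg⟩ x (hx x (Finset.mem_singleton_self x)))

namespace ChamberSystem.LegalColouring

variable {I C : Type*} {M : CoxeterMatrix I} {X : I → Type*} {S : ChamberSystem I C}
variable (col : S.LegalColouring X) {F : ∀ i, Subgroup (Equiv.Perm (X i))}

theorem isCancelSMul_universalGroup (hS : ∀ c d, S.Joined c d)
    (hF : ∀ i, IsCancelSMul (F i) (X i)) : IsCancelSMul (col.universalGroup F) C := by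
  refine isCancelSMul_iff_eq_one_of_smul_eq.2 ?_
  rintro ⟨g, hg, hgF⟩ c (hgc : g c = c)
  refine Subtype.ext (Equiv.ext fun d => (?_ : g d = d))
  induction hS c d with
  | refl => exact hgc
  | @tail d e _ hadj hd =>
    obtain ⟨i, hi⟩ := hadj
    have happly := fun {a} ha => col.localAction_apply ⟨g, hg⟩ (S.panelOf i d) (c := a) ha
    have hone : col.localAction ⟨g, hg⟩ (S.panelOf i d) = 1 :=
      congrArg Subtype.val <| isCancelSMul_iff_eq_one_of_smul_eq.1 (hF i) ⟨_, hgF i _⟩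
        (col.toFun d i) ((happly ((S.adj i).refl d)).trans (congrArg (col.toFun · i) hd))
    have hge : S.adj i (g e) e :=
      (S.adj i).trans ((S.adj i).symm ((hg i d e).2 hi)) (hd.symm ▸ hi)
    refine col.eq_of_adj hge ?_
    rw [← happly ((S.adj i).symm hi), hone, Equiv.Perm.one_apply]

theorem isCancelSMul_of_universalGroup [Nonempty C] (hS : S.IsBuilding M) (hM : M.IsRightAngled)
    (h : IsCancelSMul (col.universalGroup F) C) (i : I) : IsCancelSMul (F i) (X i) := by
  refine col.isCancelSMul_of_forall_exists_wing hS hM fun x => ?_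
  obtain ⟨c, -, hc⟩ := col.exists_adj_apply_eq i x (Classical.arbitrary C)
  refine ⟨c, hc, fun g hg hfix => ?_⟩
  exact congrArg Subtype.val
    (isCancelSMul_iff_eq_one_of_smul_eq.1 h ⟨g, hg⟩ c (hfix c (S.self_mem_wing M i c)))

theorem isCancelSMul_of_discreteTopology [Nonempty C] (hS : S.IsBuilding M) (hM : M.IsRightAngled)
    {i : I} (hi : ¬ M.diagram.IsIsolated i)
    (h : @DiscreteTopology (col.universalGroup F) (permutationTopology (col.universalGroup F))) :
    IsCancelSMul (F i) (X i) := by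
  obtain ⟨Φ, hΦ⟩ := discreteTopology_permutationTopology_iff.1 h
  obtain ⟨j, hne, hj⟩ := M.diagram.neighborSet_nonempty.2 hi
  refine col.isCancelSMul_of_forall_exists_wing hS hM fun x => ?_
  obtain ⟨c, hc, hsub⟩ :=
    col.exists_finset_subset_wing_apply_eq hS hM ((hM i j hne).resolve_left hj) Φ x
  exact ⟨c, hc, fun g hg hfix => hΦ g hg fun d hd => hfix d (hsub hd)⟩

end ChamberSystem.LegalColouring

theorem mainTheorem12_general {I C : Type*} [Nonempty C] {X : I → Type*}
    (M : CoxeterMatrix I) (hM : M.IsRightAngled)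
    (S : ChamberSystem I C) (hS : S.IsBuilding M)
    (col : S.LegalColouring X) (F : ∀ i, Subgroup (Equiv.Perm (X i))) :
    ((∀ i, IsCancelSMul (F i) (X i)) ↔ IsCancelSMul (col.universalGroup F) C) ∧
    (IsCancelSMul (col.universalGroup F) C →
      @DiscreteTopology (col.universalGroup F) (permutationTopology (col.universalGroup F))) ∧
    ((∀ i, ¬ M.diagram.IsIsolated i) →
      List.TFAE [
        ∀ i, IsCancelSMul (F i) (X i),
        IsCancelSMul (col.universalGroup F) C,
        @DiscreteTopology (col.universalGroup F)
          (permutationTopology (col.universalGroup F))]) := by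
  have free_of_free_local := col.isCancelSMul_universalGroup (F := F) hS.joined
  have free_local_of_free := col.isCancelSMul_of_universalGroup (F := F) hS hM
  have discrete_of_free :=
    discreteTopology_permutationTopology_of_isCancelSMul (G := col.universalGroup F)
  refine ⟨⟨free_of_free_local, free_local_of_free⟩, discrete_of_free, fun hisolated => ?_⟩
  tfae_have 1 → 2 := free_of_free_local
  tfae_have 2 → 3 := discrete_of_free
  tfae_have 3 → 1 := fun h i => col.isCancelSMul_of_discreteTopology hS hM (hisolated i) h
  tfae_finish

theorem mainTheorem12 {I : Type w} [Finite I] {C : Type u} [Nonempty C] {X : I → Type v}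
    (M : CoxeterMatrix I) (hM : M.IsRightAngled)
    (S : ChamberSystem I C) (hS : S.IsBuilding M)
    (q : I → Cardinal.{u}) (hq : S.IsSemiregular q)
    (hX : ∀ i, Cardinal.lift.{u} (Cardinal.mk (X i)) = Cardinal.lift.{v} (q i))
    (col : S.LegalColouring X) (F : ∀ i, Subgroup (Equiv.Perm (X i))) :
    ((∀ i, IsCancelSMul (F i) (X i)) ↔ IsCancelSMul (col.universalGroup F) C) ∧
    (IsCancelSMul (col.universalGroup F) C →
      @DiscreteTopology (col.universalGroup F) (permutationTopology (col.universalGroup F))) ∧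
    ((∀ i, ¬ M.diagram.IsIsolated i) →
      List.TFAE [
        ∀ i, IsCancelSMul (F i) (X i),
        IsCancelSMul (col.universalGroup F) C,
        @DiscreteTopology (col.universalGroup F)
          (permutationTopology (col.universalGroup F))]) :=
  mainTheorem12_general M hM S hS col F
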